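/- Throughout, a digraph is finite and has no loops and at most two edges $xy$, $yx$ between any two distinct vertices $x,y$. For a digraph $G$ let $|G|$ denote its number of vertices, and let $\delta^+(G)$ and $\Delta^+(G)$ denote the minimum and the maximum out-degree of its vertices. Let $\vec T_s$ be the transitive tournament on $s$ vertices. A $\vec T_s$-factor of $G$ is a set of pairwise vertex-disjoint subdigraphs of $G$, each isomorphic to $\vec T_s$, that together cover all vertices of $G$. An equitable acyclic $k$-coloring of $G$ is a coloring of the vertices of $G$ with $k$ colors (some color classes may be empty) such that every color class induces a subdigraph with no directed cycle (directed $2$-cycles included) and the sizes of any two color classes differ by at most one. (1) Let $s\ge 1$ and $k$ be integers. Every digraph $G$ with $|G|=n=sk$ and $\delta^+(G)\ge (1-1/s)n$ has a $\vec T_s$-factor. (2) Let $k$ be a nonnegative integer. Every digraph $G$ with $\Delta^+(G)\le k-1$ has an equitable acyclic $k$-coloring. -/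

import Mathlib

namespace Digraph

/-- A digraph is simple if it has no loops. (An adjacency relation already has at most one edge in
each direction between two vertices.) -/
def IsSimple {V : Type*} (G : Digraph V) : Prop :=
  ∀ v : V, ¬ G.Adj v v

/-- The out-degree `d⁺(v)`. -/
noncomputable def outDegree {V : Type*} (G : Digraph V) (v : V) : ℕ :=
  {w : V | G.Adj v w}.ncard

/-- The minimum out-degree `δ⁺(G)` (it is `0` if there are no vertices). -/
noncomputable def minOutDegree {V : Type*} (G : Digraph V) : ℕ :=
  ⨅ v : V, G.outDegree v

/-- The maximum out-degree `Δ⁺(G)` of a finite digraph (it is `0` if there are no vertices). -/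
noncomputable def maxOutDegree {V : Type*} [Fintype V] (G : Digraph V) : ℕ :=
  Finset.univ.sup G.outDegree

/-- The subdigraph induced on a set of vertices. -/
def induce {V : Type*} (G : Digraph V) (S : Set V) : Digraph S where
  Adj v w := G.Adj v w

/-- A digraph is acyclic if no vertex can be reached from itself by a directed walk of positive
length, i.e. if it has no directed cycle (2-cycles and loops included). -/
def IsAcyclic {V : Type*} (G : Digraph V) : Prop :=
  ∀ v : V, ¬ Relation.TransGen G.Adj v v

/-- `f` is an equitable acyclic `k`-coloring of `G`: each of its `k` color classes induces an
acyclic digraph, and the sizes of any two color classes differ by at most one. -/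
def IsEquitableAcyclicColoring {V : Type*} (G : Digraph V) {k : ℕ} (f : V → Fin k) : Prop :=
  (∀ i : Fin k, (G.induce (f ⁻¹' {i})).IsAcyclic) ∧
    ∀ i j : Fin k, (f ⁻¹' {i}).ncard ≤ (f ⁻¹' {j}).ncard + 1

/-- The transitive tournament on `s` vertices. -/
def transitiveTournament (s : ℕ) : Digraph (Fin s) where
  Adj i j := i < j

/-- A subdigraph (not necessarily induced or spanning): a set of vertices and a set of edges of `G`
with both ends among these vertices. -/
structure Subdigraph {V : Type*} (G : Digraph V) where
  verts : Set V
  Adj : V → V → Prop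
  adj_sub : ∀ {v w : V}, Adj v w → G.Adj v w
  fst_mem : ∀ {v w : V}, Adj v w → v ∈ verts
  snd_mem : ∀ {v w : V}, Adj v w → w ∈ verts

/-- A subdigraph as a digraph on its own vertex set. -/
def Subdigraph.coe {V : Type*} {G : Digraph V} (T : G.Subdigraph) : Digraph T.verts where
  Adj v w := T.Adj v w

/-- `T` is a copy of `H`, i.e. it is isomorphic to `H`. -/
def Subdigraph.IsCopyOf {V W : Type*} {G : Digraph V} (T : G.Subdigraph) (H : Digraph W) : Prop :=
  Nonempty (H.Adj ≃r T.coe.Adj)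

/-- `G` has an `H`-factor: a set of vertex-disjoint subdigraphs of `G` (tiles), each of them a copy
of `H`, which together cover all vertices of `G`. -/
def HasFactor {V W : Type*} (G : Digraph V) (H : Digraph W) : Prop :=
  ∃ F : Set G.Subdigraph,
    F.PairwiseDisjoint Subdigraph.verts ∧ (⋃ T ∈ F, T.verts) = Set.univ ∧ ∀ T ∈ F, T.IsCopyOf H

end Digraph

/-! Part (1) follows from a coloring of the complementary digraph: an acyclic set of size s there,
listed so that no edge points forward, spans a transitive tournament in G. Part (2) is reduced to
the case where k divides the number of vertices by padding. So everything rests on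
`exists_equitable_coloring`, a directed form of the Kierstead–Kostochka argument for the
Hajnal–Szemerédi theorem.

Out-edges are switched on vertex by vertex; each time one vertex x must be recolored while its
former class a is one short (`exists_coloring_of_erase`). A class is accessible if it can pass a
vertex on to class a by moves that keep classes acyclic. If x fits into an accessible class,
vertices are shifted along a path. Otherwise let B consist of x and the vertices of the q
inaccessible classes. A vertex of B fits into no accessible class, so it has an out-neighbor and an
in-neighbor in each. Hence out-degrees within B are below q, and B minus any one vertex can be
colored with the q colors by induction.

It remains to exchange some y in B for some z in an accessible class. The class of z is taken from a
set T of classes whose removal, one at a time, keeps all others accessible (`exists_terminal`). If z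
can leave for another accessible class and y can replace it, the coloring is complete. If this never
happens, counting in-neighbors gives q < |T| (`lt_of_two_le_in_degrees`). Counting out-neighbors
then gives y, y' in B, not spanning a 2-cycle, with the same sole out-neighbor z in a class of T
(`exists_common_solo`). Now y replaces z, z becomes the uncolored vertex, and y' can follow y, so a
further class becomes accessible. -/

namespace AcyclicColoring

open Finset Relation
open scoped Classical

variable {V κ : Type*}

/-- Every nonempty subset of `S` has a vertex with no out-neighbor in it; for a finite set this says
that `R` has no directed cycle within `S`. -/
def AcyclicOn (R : V → V → Prop) (S : Finset V) : Prop :=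
  ∀ T ⊆ S, T.Nonempty → ∃ v ∈ T, ∀ w ∈ T, ¬ R v w

/-! ### Acyclic sets and adding vertices to them -/

section AcyclicOn

variable {R : V → V → Prop} {S : Finset V}

lemma AcyclicOn.mono {S' : Finset V} (h : AcyclicOn R S) (hS : S' ⊆ S) : AcyclicOn R S' :=
  fun T hT => h T (hT.trans hS)

lemma AcyclicOn.insert_of_no_out (hR : ∀ v, ¬ R v v) (h : AcyclicOn R S) {y : V}
    (hy : ∀ w ∈ S, ¬ R y w) : AcyclicOn R (insert y S) := by
  intro T hT hne
  by_cases hyT : y ∈ T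
  · refine ⟨y, hyT, fun w hw hyw => ?_⟩
    rcases mem_insert.1 (hT hw) with rfl | hwS
    · exact hR _ hyw
    · exact hy w hwS hyw
  · exact h T ((subset_insert_iff_of_notMem hyT).1 hT) hne

/-- Nothing points to y, so a sink of the remaining vertices is still a sink once y is added. -/
lemma AcyclicOn.insert_of_no_in (hR : ∀ v, ¬ R v v) (h : AcyclicOn R S) {y : V}
    (hy : ∀ w ∈ S, ¬ R w y) : AcyclicOn R (insert y S) := by
  intro T hT hne
  rcases (T.erase y).eq_empty_or_nonempty with he | he
  · obtain ⟨v, hv⟩ := hne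
    have hall : ∀ w ∈ T, w = y := fun w hw => by
      by_contra hwy
      exact notMem_empty w (he ▸ mem_erase.2 ⟨hwy, hw⟩)
    exact ⟨v, hv, fun w hw => by rw [hall v hv, hall w hw]; exact hR y⟩
  · have hsub : T.erase y ⊆ S := by
      intro w hw
      exact (mem_insert.1 (hT (mem_of_mem_erase hw))).resolve_left (ne_of_mem_erase hw)
    obtain ⟨v, hv, hvT⟩ := h _ hsub he
    refine ⟨v, mem_of_mem_erase hv, fun w hw => ?_⟩
    by_cases hwy : w = y
    · exact hwy ▸ hy v (hsub hv)
    · exact hvT w (mem_erase.2 ⟨hwy, hw⟩)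

lemma AcyclicOn.exists_out (hR : ∀ v, ¬ R v v) (h : AcyclicOn R S) {y : V}
    (hy : ¬ AcyclicOn R (insert y S)) : ∃ w ∈ S, R y w := by
  by_contra! hc
  exact hy (h.insert_of_no_out hR hc)

lemma AcyclicOn.exists_in (hR : ∀ v, ¬ R v v) (h : AcyclicOn R S) {y : V}
    (hy : ¬ AcyclicOn R (insert y S)) : ∃ w ∈ S, R w y := by
  by_contra! hc
  exact hy (h.insert_of_no_in hR hc)

/-- Two vertices which do not span a 2-cycle can be added to an acyclic set which contains no
out-neighbor of either. -/
lemma AcyclicOn.insert_insert (hR : ∀ v, ¬ R v v) (h : AcyclicOn R S) {y z : V}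
    (hy : ∀ w ∈ S, ¬ R y w) (hz : ∀ w ∈ S, ¬ R z w) (hyz : ¬ (R y z ∧ R z y)) :
    AcyclicOn R (insert y (insert z S)) := by
  by_cases hyz' : R y z
  · rw [insert_comm]
    refine (h.insert_of_no_out hR hy).insert_of_no_out hR fun w hw => ?_
    rcases mem_insert.1 hw with rfl | hw
    · exact fun hzy => hyz ⟨hyz', hzy⟩
    · exact hz w hw
  · refine (h.insert_of_no_out hR hz).insert_of_no_out hR fun w hw => ?_
    rcases mem_insert.1 hw with rfl | hw
    · exact hyz'
    · exact hy w hw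

end AcyclicOn

/-! ### Colorings with prescribed class sizes -/

section Colorings

/-- The vertices of `Y` with color `c`. -/
noncomputable def colorClass (Y : Finset V) (f : V → κ) (c : κ) : Finset V :=
  Y.filter (f · = c)

@[simp] lemma mem_colorClass {Y : Finset V} {f : V → κ} {c : κ} {v : V} :
    v ∈ colorClass Y f c ↔ v ∈ Y ∧ f v = c := by
  simp [colorClass]

/-- `f` colors `Y` with colors from `D`; the color classes are acyclic and have sizes `σ`. -/
structure IsColoring (R : V → V → Prop) (Y : Finset V) (D : Finset κ) (f : V → κ) (σ : κ → ℕ) :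
    Prop where
  mem : ∀ y ∈ Y, f y ∈ D
  acyclic : ∀ c ∈ D, AcyclicOn R (colorClass Y f c)
  card : ∀ c ∈ D, #(colorClass Y f c) = σ c

variable {R : V → V → Prop} {Y : Finset V} {D : Finset κ} {f : V → κ} {σ : κ → ℕ}

lemma colorClass_filter {D' : Finset κ} {c : κ} (hc : c ∈ D') :
    colorClass (Y.filter (f · ∈ D')) f c = colorClass Y f c := by
  ext v
  simp only [mem_colorClass, mem_filter]
  exact ⟨fun h => ⟨h.1.1, h.2⟩, fun h => ⟨⟨h.1, h.2 ▸ hc⟩, h.2⟩⟩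

lemma IsColoring.restrict (h : IsColoring R Y D f σ) {D' : Finset κ} (hD : D' ⊆ D) :
    IsColoring R (Y.filter (f · ∈ D')) D' f σ where
  mem y hy := (mem_filter.1 hy).2
  acyclic c hc := by rw [colorClass_filter hc]; exact h.acyclic c (hD hc)
  card c hc := by rw [colorClass_filter hc]; exact h.card c (hD hc)

lemma IsColoring.card_eq (h : IsColoring R Y D f σ) : #Y = ∑ c ∈ D, σ c := by
  rw [card_eq_sum_card_fiberwise (f := f) (t := D) (fun y hy => h.mem y hy)]
  exact sum_congr rfl fun c hc => h.card c hc

lemma IsColoring.card_filter (h : IsColoring R Y D f σ) (P : V → Prop) :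
    #(Y.filter P) = ∑ c ∈ D, #((colorClass Y f c).filter P) := by
  rw [card_eq_sum_card_fiberwise (f := f) (t := D)
    (fun y hy => h.mem y (mem_of_mem_filter y hy))]
  refine sum_congr rfl fun c _ => ?_
  rw [colorClass, filter_filter, filter_filter]
  simp only [and_comm]

lemma IsColoring.single {S : Finset V} (hS : AcyclicOn R S) {c : κ} (hc : #S = σ c) :
    IsColoring R S {c} (fun _ => c) σ where
  mem _ _ := mem_singleton_self c
  acyclic d hd := hS.mono (filter_subset _ _)
  card d hd := by
    rw [mem_singleton.1 hd, colorClass, filter_true_of_mem fun _ _ => rfl, hc]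

/-- Colorings of disjoint sets with disjoint sets of colors fit together. -/
lemma IsColoring.union {Y' : Finset V} {D' : Finset κ} {f' : V → κ} (h : IsColoring R Y D f σ)
    (h' : IsColoring R Y' D' f' σ) (hY : Disjoint Y Y') (hD : Disjoint D D') :
    ∃ g : V → κ, IsColoring R (Y ∪ Y') (D ∪ D') g σ ∧
      (∀ c ∈ D, colorClass (Y ∪ Y') g c = colorClass Y f c) ∧
      (∀ c ∈ D', colorClass (Y ∪ Y') g c = colorClass Y' f' c) ∧ ∀ v ∈ Y', g v = f' v := by
  obtain ⟨g, h1, h2⟩ : ∃ g : V → κ, (∀ v ∈ Y, g v = f v) ∧ ∀ v ∈ Y', g v = f' v :=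
    ⟨fun v => if v ∈ Y then f v else f' v, fun v hv => if_pos hv,
      fun v hv => if_neg fun hv' => disjoint_left.1 hY hv' hv⟩
  have e1 : ∀ c ∈ D, colorClass (Y ∪ Y') g c = colorClass Y f c := by
    intro c hc
    ext v
    simp only [mem_colorClass, mem_union]
    constructor
    · rintro ⟨hv | hv, e⟩
      · exact ⟨hv, h1 v hv ▸ e⟩
      · exact absurd (h'.mem v hv) (disjoint_left.1 hD (by rw [← h2 v hv, e]; exact hc))
    · rintro ⟨hv, e⟩
      exact ⟨.inl hv, by rw [h1 v hv, e]⟩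
  have e2 : ∀ c ∈ D', colorClass (Y ∪ Y') g c = colorClass Y' f' c := by
    intro c hc
    ext v
    simp only [mem_colorClass, mem_union]
    constructor
    · rintro ⟨hv | hv, e⟩
      · exact absurd hc (disjoint_left.1 hD (by rw [← e, h1 v hv]; exact h.mem v hv))
      · exact ⟨hv, h2 v hv ▸ e⟩
    · rintro ⟨hv, e⟩
      exact ⟨.inr hv, by rw [h2 v hv, e]⟩
  refine ⟨g, ⟨fun y hy => ?_, fun c hc => ?_, fun c hc => ?_⟩, e1, e2, h2⟩
  · rcases mem_union.1 hy with hy | hy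
    · rw [h1 y hy]; exact mem_union_left _ (h.mem y hy)
    · rw [h2 y hy]; exact mem_union_right _ (h'.mem y hy)
  · rcases mem_union.1 hc with hc | hc
    · rw [e1 c hc]; exact h.acyclic c hc
    · rw [e2 c hc]; exact h'.acyclic c hc
  · rcases mem_union.1 hc with hc | hc
    · rw [e1 c hc]; exact h.card c hc
    · rw [e2 c hc]; exact h'.card c hc

/-- Some vertex of color `c` can be moved to color class `d`. -/
def CanMove (R : V → V → Prop) (Y : Finset V) (f : V → κ) (c d : κ) : Prop :=
  ∃ y ∈ Y, f y = c ∧ AcyclicOn R (insert y (colorClass Y f d))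

end Colorings

/-! ### Reachability after deleting a vertex -/

section Reachability

/-- The relation `r` with the vertex `u` deleted. -/
def avoid (r : κ → κ → Prop) (u : κ) (c d : κ) : Prop := r c d ∧ c ≠ u ∧ d ≠ u

variable {r : κ → κ → Prop} {a : κ}

/-- Take the step after the last visit to c. -/
lemma exists_first_step_of_reflTransGen {c : κ} (h : ReflTransGen r c a) (hc : c ≠ a) :
    ∃ d, r c d ∧ d ≠ c ∧ ReflTransGen (avoid r c) d a := by
  have key : ∀ b, ReflTransGen r b a → (b ≠ c ∧ ReflTransGen (avoid r c) b a) ∨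
      ∃ d, r c d ∧ d ≠ c ∧ ReflTransGen (avoid r c) d a := by
    intro b hb
    induction hb using ReflTransGen.head_induction_on with
    | refl => exact .inl ⟨hc.symm, .refl⟩
    | @head b b' hbb' _ ih =>
      rcases ih with ⟨hb', h'⟩ | h'
      · by_cases hbc : b = c
        · exact .inr ⟨b', hbc ▸ hbb', hb', h'⟩
        · exact .inl ⟨hbc, .head ⟨hbb', hbc, hb'⟩ h'⟩
      · exact .inr h'
  rcases key c h with h | h
  · exact absurd rfl h.1
  · exact h

/-- If some vertex other than `a` reaches `a`, then there are a vertex `u` and a nonempty set `T` of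
vertices which reach `a`, but only through `u`, such that deleting any vertex of `T` does not stop
any other vertex from reaching `a`. -/
lemma exists_terminal [Finite κ] {c₀ : κ} (h₀ : ReflTransGen r c₀ a) (hc₀ : c₀ ≠ a) :
    ∃ (u : κ) (T : Finset κ), ReflTransGen r u a ∧ T.Nonempty ∧
      (∀ c ∈ T, c ≠ u ∧ c ≠ a ∧ ReflTransGen r c a) ∧
      (∀ w ∈ T, ∀ c, ReflTransGen r c a → c ≠ w → ReflTransGen (avoid r w) c a) ∧
      ∀ c ∈ T, ∀ d, r c d → ReflTransGen r d a → d = u ∨ d ∈ T := by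
  have := Fintype.ofFinite κ
  let T : κ → Finset κ := fun u =>
    univ.filter fun c => ReflTransGen r c a ∧ c ≠ u ∧ ¬ ReflTransGen (avoid r u) c a
  have hT : ∀ u c, c ∈ T u ↔ ReflTransGen r c a ∧ c ≠ u ∧ ¬ ReflTransGen (avoid r u) c a :=
    fun u c => by simp [T]
  let Us : Finset κ := univ.filter fun u => ReflTransGen r u a ∧ (T u).Nonempty
  have haU : a ∈ Us := by
    refine mem_filter.2 ⟨mem_univ _, .refl, c₀, (hT _ _).2 ⟨h₀, hc₀, fun h => ?_⟩⟩
    rcases ReflTransGen.cases_tail h with h | ⟨b, _, hb⟩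
    · exact hc₀ h.symm
    · exact hb.2.2 rfl
  -- `T u` is the set cut off from a by deleting u; u is chosen with the smallest nonempty such set.
  obtain ⟨u, hu, hmin⟩ := exists_min_image Us (fun u => #(T u)) ⟨a, haU⟩
  obtain ⟨-, hua, hne⟩ := mem_filter.1 hu
  -- A path to a that avoids u cannot meet `T u`, so it avoids w too.
  have hstep : ∀ w ∈ T u, ∀ c, c ≠ u → ReflTransGen (avoid r u) c a →
      c ≠ w ∧ ReflTransGen (avoid r w) c a := by
    intro w hw c hcu hc
    have hw' := (hT _ _).1 hw
    induction hc using ReflTransGen.head_induction_on with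
    | refl => exact ⟨fun e => hw'.2.2 (e ▸ .refl), .refl⟩
    | @head b b' hb hb' ih =>
      have := ih hb.2.2
      have hbw : b ≠ w := fun e => hw'.2.2 (e ▸ .head hb hb')
      exact ⟨hbw, .head ⟨hb.1, hbw, this.1⟩ this.2⟩
  have hnotT : ∀ c, ReflTransGen r c a → c ≠ u → c ∉ T u → ReflTransGen (avoid r u) c a := by
    intro c hc hcu hcT
    by_contra h
    exact hcT ((hT _ _).2 ⟨hc, hcu, h⟩)
  refine ⟨u, T u, hua, hne, fun c hc => ?_, fun w hw c hc hcw => ?_, fun c hc d hcd hd => ?_⟩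
  · have hc' := (hT _ _).1 hc
    exact ⟨hc'.2.1, fun e => hc'.2.2 (e ▸ .refl), hc'.1⟩
  · by_contra hcon
    have hcT : c ∈ T w := (hT _ _).2 ⟨hc, hcw, hcon⟩
    have hwu := (hT _ _).1 hw
    -- Whatever w cuts off is already cut off by u, so a nonempty `T w` would contradict minimality.
    have hsub : T w ⊆ (T u).erase w := by
      intro d hd
      have hd' := (hT _ _).1 hd
      refine mem_erase.2 ⟨hd'.2.1, ?_⟩
      by_contra hdT
      by_cases hdu : d = u
      · subst hdu
        by_cases hda : d = a
        · exact hd'.2.2 (hda ▸ .refl)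
        · obtain ⟨e, hde, hed, hea⟩ := exists_first_step_of_reflTransGen hd'.1 hda
          have := hstep w hw e hed hea
          exact hd'.2.2 (.head ⟨hde, hd'.2.1, this.1⟩ this.2)
      · exact hd'.2.2 (hstep w hw d hdu (hnotT d hd'.1 hdu hdT)).2
    have h1 := hmin w (mem_filter.2 ⟨mem_univ _, hwu.1, c, hcT⟩)
    have h2 := card_le_card hsub
    have h3 := card_erase_lt_of_mem hw
    omega
  · by_contra! hcon
    have hc' := (hT _ _).1 hc
    exact hc'.2.2 (.head ⟨hcd, hc'.2.1, hcon.1⟩ (hnotT d hd hcon.1 hcon.2))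

end Reachability

/-! ### Double counting -/

section Counting

variable {R : V → V → Prop}

lemma sum_card_filter_comm {α β : Type*} (P : α → β → Prop) (A : Finset α) (B : Finset β) :
    ∑ x ∈ A, #(B.filter fun y => P x y) = ∑ y ∈ B, #(A.filter fun x => P x y) :=
  sum_card_bipartiteAbove_eq_sum_card_bipartiteBelow P

/-- Count edges into B, those from N with weight 2 and those from M with weight 1. If t ≤ q, each
vertex of M and N contributes at most 2q, which totals less than 2|B|. -/
lemma lt_of_two_le_in_degrees {M N B : Finset V} {q t : ℕ}
    (hB : ∀ y ∈ B, 2 ≤ 2 * #(N.filter fun z => R z y) + #(M.filter fun z => R z y))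
    (hN : ∀ z ∈ N, #(B.filter fun y => R z y) ≤ q)
    (hM : ∀ z ∈ M, #(B.filter fun y => R z y) ≤ q + t)
    (hcard : #B = q * (#M + #N) + 1) : q < t := by
  have h1 : #B * 2 ≤ 2 * ∑ z ∈ N, #(B.filter fun y => R z y) +
      ∑ z ∈ M, #(B.filter fun y => R z y) := by
    rw [sum_card_filter_comm R N B, sum_card_filter_comm R M B, mul_sum, ← sum_add_distrib,
      ← smul_eq_mul]
    exact card_nsmul_le_sum _ _ _ hB
  have h2 : ∑ z ∈ N, #(B.filter fun y => R z y) ≤ #N * q := by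
    simpa using sum_le_card_nsmul _ _ _ hN
  have h3 : ∑ z ∈ M, #(B.filter fun y => R z y) ≤ #M * (q + t) := by
    simpa using sum_le_card_nsmul _ _ _ hM
  by_contra! hc
  have h4 : #M * (q + t) ≤ #M * (q + q) := Nat.mul_le_mul_left _ (by omega)
  nlinarith

/-- A maximal set of vertices no two of which span a 2-cycle. -/
lemma exists_maximal_no_two_cycle (R : V → V → Prop) (B : Finset V) :
    ∃ I ⊆ B, (I : Set V).Pairwise (fun y z => ¬ (R y z ∧ R z y)) ∧
      #B ≤ ∑ y ∈ I, (#(B.filter fun w => R y w) + 1) := by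
  let F := B.powerset.filter fun I : Finset V => (I : Set V).Pairwise fun y z => ¬ (R y z ∧ R z y)
  obtain ⟨I, hI, hmax⟩ := exists_max_image F card ⟨∅, by simp [F]⟩
  obtain ⟨hIB, hind⟩ := mem_filter.1 hI
  rw [mem_powerset] at hIB
  refine ⟨I, hIB, hind, ?_⟩
  have hsub : B ⊆ I.biUnion fun y => insert y (B.filter fun w => R y w) := by
    intro v hv
    by_contra hcon
    simp only [mem_biUnion, mem_insert, mem_filter, not_exists, not_and, not_or] at hcon
    have hvI : v ∉ I := fun h => (hcon v h).1 rfl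
    have hmem : insert v I ∈ F := by
      refine mem_filter.2 ⟨mem_powerset.2 (insert_subset hv hIB), ?_⟩
      rw [coe_insert, Set.pairwise_insert]
      exact ⟨hind, fun y hy _ => ⟨fun h => (hcon y hy).2 hv h.2, fun h => (hcon y hy).2 hv h.1⟩⟩
    have := hmax _ hmem
    rw [card_insert_of_notMem hvI] at this
    omega
  refine (card_le_card hsub).trans (card_biUnion_le.trans (sum_le_sum fun y _ => ?_))
  exact card_insert_le _ _

/-- Sum `hB` over a maximal I ⊆ B without 2-cycles: there are at least |I|(t - q) + |B| pairs
satisfying P. Since q|I| ≥ |B| > qs, also |I| > s, so the pairs outnumber |S| = ts and some z occurs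
twice. -/
lemma exists_common_solo {B S : Finset V} {q t s : ℕ} (P : V → V → Prop)
    (hB : ∀ y ∈ B, t + 1 + #(B.filter fun w => R y w) ≤ q + #(S.filter fun z => P y z))
    (hq : ∀ y ∈ B, #(B.filter fun w => R y w) + 1 ≤ q) (hqt : q < t)
    (hBcard : #B = q * s + 1) (hS : #S = t * s) :
    ∃ y ∈ B, ∃ y' ∈ B, y ≠ y' ∧ ¬ (R y y' ∧ R y' y) ∧ ∃ z ∈ S, P y z ∧ P y' z := by
  obtain ⟨I, hIB, hind, hI⟩ := exists_maximal_no_two_cycle R B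
  have h1 : ∑ y ∈ I, (t + (#(B.filter fun w => R y w) + 1)) ≤
      ∑ y ∈ I, (q + #(S.filter fun z => P y z)) :=
    sum_le_sum fun y hy => by have := hB y (hIB hy); omega
  have h2 : ∑ y ∈ I, (#(B.filter fun w => R y w) + 1) ≤ #I * q := by
    simpa using sum_le_card_nsmul _ _ _ fun y hy => hq y (hIB hy)
  rw [sum_add_distrib, sum_add_distrib (f := fun _ => q), sum_const, sum_const, smul_eq_mul,
    smul_eq_mul, sum_card_filter_comm] at h1
  have h3 : ∑ _z ∈ S, 1 < ∑ z ∈ S, #(I.filter fun y => P y z) := by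
    rw [sum_const, smul_eq_mul, mul_one, hS]
    obtain ⟨e, rfl⟩ := Nat.exists_eq_add_of_lt hqt
    have h4 : s < #I := by
      by_contra! hc
      have := Nat.mul_le_mul_right q hc
      nlinarith
    nlinarith
  obtain ⟨z, hz, hz'⟩ := exists_lt_of_sum_lt h3
  obtain ⟨y, hy, y', hy', hne⟩ := one_lt_card.1 hz'
  rw [mem_filter] at hy hy'
  exact ⟨y, hIB hy.1, y', hIB hy'.1, hne, hind hy.1 hy'.1 hne, z, hz, hy.2, hy'.2⟩

end Counting

/-! ### Shifting vertices and accessible classes -/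

section NearEquitable

variable {R : V → V → Prop} {Y : Finset V} {D : Finset κ} {f : V → κ} {σ : κ → ℕ}

lemma IsColoring.congr_card {σ' : κ → ℕ} (h : IsColoring R Y D f σ) (hσ : ∀ c ∈ D, σ c = σ' c) :
    IsColoring R Y D f σ' :=
  ⟨h.mem, h.acyclic, fun c hc => (h.card c hc).trans (hσ c hc)⟩

lemma CanMove.restrict {D' : Finset κ} {c d : κ} (h : CanMove R Y f c d) (hc : c ∈ D')
    (hd : d ∈ D') : CanMove R (Y.filter (f · ∈ D')) f c d := by
  obtain ⟨y, hy, rfl, hyd⟩ := h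
  exact ⟨y, mem_filter.2 ⟨hy, hc⟩, rfl, by rwa [colorClass_filter hd]⟩

/-- If `x` can be moved to a class from which one can get to class `a`, then moving one vertex
along each step of a path yields a coloring of `Y ∪ {x}` in which only class `a` is larger. -/
lemma IsColoring.exists_shift {a : κ} {σ' : κ → ℕ} (r : κ → κ → Prop)
    (h : IsColoring R Y D f σ) (hr : ∀ c d, r c d → c ∈ D ∧ d ∈ D ∧ CanMove R Y f c d)
    (hσ : ∀ c ∈ D, σ' c = σ c + if c = a then 1 else 0) {c : κ} {x : V} (hc : c ∈ D) (hx : x ∉ Y)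
    (hxc : AcyclicOn R (insert x (colorClass Y f c))) (hca : ReflTransGen r c a) :
    ∃ g, IsColoring R (insert x Y) D g σ' := by
  induction D using Finset.strongInduction generalizing r Y f c x with
  | H D ih =>
    have hrest := h.restrict (erase_subset c D)
    by_cases hne : c = a
    · subst hne
      have h1 := hrest.congr_card (σ' := σ') fun d hd => by
        rw [hσ d (mem_of_mem_erase hd), if_neg (ne_of_mem_erase hd), add_zero]
      have h2 : IsColoring R (insert x (colorClass Y f c)) {c} (fun _ => c) σ' := by
        refine IsColoring.single hxc ?_
        rw [card_insert_of_notMem (fun h' => hx (mem_colorClass.1 h').1), h.card c hc, hσ c hc,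
          if_pos rfl]
      obtain ⟨g, hg, -⟩ := h1.union h2
        (by
          rw [disjoint_left]
          intro v hv hv'
          simp only [mem_filter, mem_erase, mem_insert, mem_colorClass] at hv hv'
          rcases hv' with rfl | hv'
          · exact hx hv.1
          · exact hv.2.1 hv'.2)
        (by simp)
      refine ⟨g, ?_⟩
      convert hg using 1
      · ext v
        have := h.mem v
        simp only [mem_filter, mem_erase, mem_insert, mem_colorClass, mem_union]
        tauto
      · rw [union_comm, ← insert_eq, insert_erase hc]
    -- The rest of the path never returns to c, so class c can be settled and the induction
    -- continues without that color, with y as the vertex to place.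
    · obtain ⟨d, hcd, hdc, hda⟩ := exists_first_step_of_reflTransGen hca hne
      obtain ⟨-, hdD, y, hyY, hyc, hyd⟩ := hr c d hcd
      have hd' : d ∈ D.erase c := mem_erase.2 ⟨hdc, hdD⟩
      obtain ⟨g, hg⟩ := ih (D.erase c) (erase_ssubset hc) (avoid r c) hrest
        (fun u v huv => by
          obtain ⟨hu, hv, hm⟩ := hr u v huv.1
          have hu' := mem_erase.2 ⟨huv.2.1, hu⟩
          have hv' := mem_erase.2 ⟨huv.2.2, hv⟩
          exact ⟨hu', hv', hm.restrict hu' hv'⟩)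
        (fun e he => hσ e (mem_of_mem_erase he)) hd' (x := y)
        (fun hy => (mem_erase.1 (mem_filter.1 hy).2).1 hyc)
        (by rwa [colorClass_filter hd']) hda
      have hyc' : y ∈ colorClass Y f c := mem_colorClass.2 ⟨hyY, hyc⟩
      have h2 : IsColoring R (insert x ((colorClass Y f c).erase y)) {c} (fun _ => c) σ' := by
        refine IsColoring.single (hxc.mono (insert_subset_insert _ (erase_subset _ _))) ?_
        rw [card_insert_of_notMem (fun h' => hx (mem_colorClass.1 (mem_of_mem_erase h')).1),
          card_erase_add_one hyc', h.card c hc, hσ c hc, if_neg hne, add_zero]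
      obtain ⟨g', hg', -⟩ := hg.union h2
        (by
          rw [disjoint_left]
          intro v hv hv'
          simp only [mem_filter, mem_erase, mem_insert, mem_colorClass] at hv hv'
          rcases hv' with rfl | hv'
          · rcases hv with rfl | hv
            · exact hx hyY
            · exact hx hv.1
          · rcases hv with rfl | hv
            · exact hv'.1 rfl
            · exact hv.2.1 hv'.2.2)
        (by simp)
      refine ⟨g', ?_⟩
      convert hg' using 1
      · ext v
        have := h.mem v
        simp only [mem_filter, mem_erase, mem_insert, mem_colorClass, mem_union]
        by_cases hvy : v = y
        · subst hvy; tauto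
        · tauto
      · rw [union_comm, ← insert_eq, insert_erase hc]

/-- The colors in `C` whose classes can pass a vertex to class `a` by a sequence of moves. -/
noncomputable def accessible (R : V → V → Prop) (Y : Finset V) (C : Finset κ) (f : V → κ) (a : κ) :
    Finset κ :=
  C.filter fun c => ReflTransGen (fun c d => c ∈ C ∧ d ∈ C ∧ CanMove R Y f c d) c a

variable {C : Finset κ} {a : κ}

lemma accessible_subset : accessible R Y C f a ⊆ C := filter_subset _ _

lemma mem_accessible_self (ha : a ∈ C) : a ∈ accessible R Y C f a :=
  mem_filter.2 ⟨ha, .refl⟩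

lemma mem_accessible_of_canMove {c d : κ} (hd : d ∈ accessible R Y C f a) (hc : c ∈ C)
    (h : CanMove R Y f c d) : c ∈ accessible R Y C f a := by
  obtain ⟨hdC, hda⟩ := mem_filter.1 hd
  exact mem_filter.2 ⟨hc, .head ⟨hc, hdC, h⟩ hda⟩

lemma reflTransGen_of_mem_accessible {c : κ} (hc : c ∈ accessible R Y C f a) :
    ReflTransGen (fun c d => c ∈ accessible R Y C f a ∧ d ∈ accessible R Y C f a ∧
      CanMove R Y f c d) c a := by
  obtain ⟨hcC, hca⟩ := mem_filter.1 hc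
  induction hca using ReflTransGen.head_induction_on with
  | refl => exact .refl
  | @head b d h h' ih =>
    have : d ∈ accessible R Y C f a := mem_filter.2 ⟨h.2.1, h'⟩
    exact .head ⟨hc, this, h.2.2⟩ (ih this h.2.1)

lemma mem_accessible_of_reflTransGen {c : κ} (ha : a ∈ C)
    (h : ReflTransGen (fun c d => c ∈ accessible R Y C f a ∧ d ∈ accessible R Y C f a ∧
      CanMove R Y f c d) c a) : c ∈ accessible R Y C f a := by
  rcases ReflTransGen.cases_head h with rfl | ⟨d, hd, -⟩
  · exact mem_accessible_self ha
  · exact hd.1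

end NearEquitable

/-! ### The exchange argument -/

lemma union_recolored {X : Finset V} {A : Finset κ} {f : V → κ} {x y z : V} {W : κ} (hW : W ∈ A)
    (hz : z ∈ colorClass (X.erase x) f W) (hy : y ∈ X.filter fun v => v = x ∨ f v ∉ A) :
    (X.erase x).filter (f · ∈ A.erase W) ∪ insert y ((colorClass (X.erase x) f W).erase z) ∪
      (X.filter fun v => v = x ∨ f v ∉ A).erase y = X.erase z := by
  ext v
  simp only [mem_filter, mem_erase, mem_insert, mem_colorClass, mem_union] at *
  grind

/-- If all of `X` but the vertex `x` is colored, with all classes of size `r + 1` except for one of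
size `r`, then `X` has an equitable coloring, provided that smaller subsets of `X` have one. -/
lemma exists_coloring_of_erase [Finite κ] {R : V → V → Prop} (hR : ∀ v, ¬ R v v) {X : Finset V}
    {C : Finset κ} {r : ℕ} {a : κ} (ha : a ∈ C) (hX : #X = #C * (r + 1))
    (hdeg : ∀ v ∈ X, #(X.filter fun w => R v w) < #C)
    (IH : ∀ X' ⊆ X, #X' < #X → ∀ C' : Finset κ, #X' = #C' * (r + 1) →
      (∀ v ∈ X', #(X'.filter fun w => R v w) < #C') →
      ∃ g, IsColoring R X' C' g fun _ => r + 1)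
    {x : V} {f : V → κ} (hx : x ∈ X)
    (hf : IsColoring R (X.erase x) C f fun c => if c = a then r else r + 1) :
    ∃ g, IsColoring R X C g fun _ => r + 1 := by
  induction hn : #C - #(accessible R (X.erase x) C f a) using Nat.strong_induction_on
    generalizing x f with
  | _ n ihn =>
  subst hn
  set Y := X.erase x with hY
  have hxY : x ∉ Y := notMem_erase x X
  set A := accessible R Y C f a with hA
  have hAC : A ⊆ C := accessible_subset
  have haA : a ∈ A := mem_accessible_self ha
  by_cases hxm : ∃ c ∈ A, AcyclicOn R (insert x (colorClass Y f c))
  · obtain ⟨c, hc, hxc⟩ := hxm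
    rw [← insert_erase hx]
    refine hf.exists_shift (a := a) _ (fun _ _ h => h) (fun d _ => ?_) (hAC hc) hxY hxc
      (mem_filter.1 hc).2
    split_ifs <;> rfl
  push Not at hxm
  -- the vertices not in accessible classes
  set B := X.filter fun v => v = x ∨ f v ∉ A with hB
  have hxB : x ∈ B := mem_filter.2 ⟨hx, .inl rfl⟩
  have hBX : B ⊆ X := filter_subset _ _
  have hclsX : ∀ c, colorClass Y f c ⊆ X := fun c => (filter_subset _ _).trans (erase_subset _ _)
  have hclsAc : ∀ c ∈ A, AcyclicOn R (colorClass Y f c) := fun c hc => hf.acyclic c (hAC hc)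
  have hBm : ∀ y ∈ B, ∀ c ∈ A, ¬ AcyclicOn R (insert y (colorClass Y f c)) := by
    intro y hy c hc hyc
    obtain ⟨hyX, hy⟩ := mem_filter.1 hy
    by_cases hyx : y = x
    · exact hxm c hc (hyx ▸ hyc)
    · have hyY : y ∈ Y := mem_erase.2 ⟨hyx, hyX⟩
      exact hy.resolve_left hyx (mem_accessible_of_canMove hc (hf.mem y hyY) ⟨y, hyY, rfl, hyc⟩)
  have hCcard : #(C \ A) + #A = #C := card_sdiff_add_card_eq_card hAC
  have hAf := hf.restrict hAC
  -- The extra 1 is the deficit of class a, which is accessible.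
  have hBcard : #B = #(C \ A) * (r + 1) + 1 := by
    have h1 : #(Y.filter (f · ∈ A)) + 1 = #A * (r + 1) := by
      rw [hAf.card_eq, ← add_sum_erase _ _ haA, if_pos rfl,
        sum_congr rfl (g := fun _ => r + 1) fun c hc => if_neg (ne_of_mem_erase hc), sum_const,
        smul_eq_mul, ← card_erase_add_one haA]
      ring
    have h2 : Disjoint B (Y.filter (f · ∈ A)) := by
      rw [disjoint_left]
      intro w
      simp only [mem_filter, hY, hB, mem_erase]
      tauto
    have h3 : B ∪ Y.filter (f · ∈ A) = X := by
      ext w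
      simp only [mem_union, mem_filter, hY, hB, mem_erase]
      tauto
    have h4 := card_union_of_disjoint h2
    rw [h3, hX, ← hCcard, add_mul] at h4
    omega
  set q := #(C \ A) with hq
  have hsplit : ∀ v ∈ X, #(B.filter fun w => R v w) +
      ∑ c ∈ A, #((colorClass Y f c).filter fun w => R v w) < #A + q := by
    intro v hv
    have h1 := hAf.card_filter fun w => R v w
    rw [sum_congr rfl fun c hc => by rw [colorClass_filter hc]] at h1
    have h2 : Disjoint (B.filter fun w => R v w)
        ((Y.filter (f · ∈ A)).filter fun w => R v w) := by
      rw [disjoint_left]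
      intro w
      simp only [mem_filter, hY, hB, mem_erase]
      tauto
    have h3 : (B.filter fun w => R v w) ∪ (Y.filter (f · ∈ A)).filter (fun w => R v w) ⊆
        X.filter fun w => R v w := by
      intro w
      simp only [mem_union, mem_filter, hY, hB, mem_erase]
      tauto
    have h4 := card_le_card h3
    have h5 := hdeg v hv
    rw [card_union_of_disjoint h2, h1] at h4
    omega
  have hsum : ∀ v, ∀ P ⊆ A, (∀ c ∈ P, ¬ AcyclicOn R (insert v (colorClass Y f c))) →
      #P ≤ ∑ c ∈ A, #((colorClass Y f c).filter fun w => R v w) := by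
    intro v P hP h
    refine le_trans ?_ (sum_le_sum_of_subset hP)
    rw [card_eq_sum_ones]
    refine sum_le_sum fun c hc => ?_
    obtain ⟨w, hw, hvw⟩ := (hclsAc c (hP hc)).exists_out hR (h c hc)
    exact card_pos.2 ⟨w, mem_filter.2 ⟨hw, hvw⟩⟩
  -- At least |A| of the fewer than |A| + q out-edges of y go to accessible classes.
  have hBq : ∀ y ∈ B, #(B.filter fun w => R y w) + 1 ≤ q := by
    intro y hy
    have h1 := hsplit y (hBX hy)
    have h2 := hsum y A Subset.rfl (hBm y hy)
    omega
  have hrec : ∀ y ∈ B, ∃ g, IsColoring R (B.erase y) (C \ A) g fun _ => r + 1 := by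
    intro y hy
    refine IH _ ((erase_subset _ _).trans hBX)
      ((card_erase_lt_of_mem hy).trans_le (card_le_card hBX)) _ ?_ fun v hv => ?_
    · rw [card_erase_of_mem hy, hBcard, Nat.add_sub_cancel]
    · have h1 := hBq v (mem_of_mem_erase hv)
      have h2 := card_le_card (filter_subset_filter (fun w => R v w) (erase_subset y B))
      omega
  -- If A = {a}, the r vertices of class a send at most rq edges to B, yet each of the more than rq
  -- vertices of B receives one.
  have hAne : ∃ c₀ ∈ A, c₀ ≠ a := by
    by_contra! hcon
    have hA1 : #A = 1 := card_eq_one.2 ⟨a, (subset_singleton_iff'.2 hcon).antisymm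
      (singleton_subset_iff.2 haA)⟩
    have h1 : #B ≤ ∑ y ∈ B, #((colorClass Y f a).filter fun z => R z y) := by
      rw [card_eq_sum_ones]
      refine sum_le_sum fun y hy => ?_
      obtain ⟨w, hw, hwy⟩ := (hclsAc a haA).exists_in hR (hBm y hy a haA)
      exact card_pos.2 ⟨w, mem_filter.2 ⟨hw, hwy⟩⟩
    rw [sum_card_filter_comm] at h1
    have h2 : ∑ z ∈ colorClass Y f a, #(B.filter fun y => R z y) ≤ #(colorClass Y f a) * q := by
      rw [← smul_eq_mul]
      refine sum_le_card_nsmul _ _ _ fun z hz => ?_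
      have := hsplit z (hclsX a hz)
      omega
    rw [hf.card a ha, if_pos rfl] at h2
    nlinarith
  obtain ⟨c₀, hc₀A, hc₀⟩ := hAne
  obtain ⟨U, T, -, hTne, hT, hterm, hTU⟩ :=
    exists_terminal (reflTransGen_of_mem_accessible hc₀A) hc₀
  rw [← hA] at hT hterm hTU
  have hTA : T ⊆ A := fun c hc => mem_accessible_of_reflTransGen ha (hT c hc).2.2
  have hTcard : ∀ c ∈ T, #(colorClass Y f c) = r + 1 := fun c hc => by
    rw [hf.card c (hAC (hTA hc)), if_neg (hT c hc).2.1]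
  have hBf : ∀ v ∈ B, v ∈ Y → f v ∉ A := fun v hv hvY =>
    (mem_filter.1 hv).2.resolve_left (ne_of_mem_erase hvY)
  have hWC : ∀ W ∈ A, A.erase W ∪ {W} ∪ C \ A = C := fun W hW => by
    rw [union_comm (A.erase W), ← insert_eq, insert_erase hW, union_sdiff_of_subset hAC]
  -- In this case y takes the place of z, z is shifted towards a avoiding W, and B minus y is
  -- recolored by induction.
  by_cases hswap : ∃ W ∈ T, ∃ z ∈ colorClass Y f W, ∃ d ∈ A, d ≠ W ∧
      AcyclicOn R (insert z (colorClass Y f d)) ∧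
      ∃ y ∈ B, AcyclicOn R (insert y ((colorClass Y f W).erase z))
  · obtain ⟨W, hWT, z, hz, d, hdA, hdW, hzd, y, hyB, hyW⟩ := hswap
    have hWA := hTA hWT
    obtain ⟨hzY, hzW⟩ := mem_colorClass.1 hz
    have hd' : d ∈ A.erase W := mem_erase.2 ⟨hdW, hdA⟩
    have hyY : y ∈ Y → f y ∉ A := hBf y hyB
    obtain ⟨g₁, hg₁⟩ := (hf.restrict ((erase_subset W A).trans hAC)).exists_shift (a := a)
      (σ' := fun _ => r + 1) (x := z) _
      (fun c e hce => by
        have hc := mem_erase.2 ⟨hce.2.1, hce.1.1⟩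
        have he := mem_erase.2 ⟨hce.2.2, hce.1.2.1⟩
        exact ⟨hc, he, hce.1.2.2.restrict hc he⟩)
      (fun c _ => by split_ifs <;> rfl) hd'
      (fun h => ne_of_mem_erase (mem_filter.1 h).2 hzW)
      (by rwa [colorClass_filter hd'])
      (hterm W hWT d (reflTransGen_of_mem_accessible hdA) hdW)
    have hycls : y ∉ (colorClass Y f W).erase z := fun h => by
      obtain ⟨h1, h2⟩ := mem_colorClass.1 (mem_of_mem_erase h)
      exact hyY h1 (h2 ▸ hWA)
    have h₂ : IsColoring R (insert y ((colorClass Y f W).erase z)) {W} (fun _ => W)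
        fun _ => r + 1 :=
      IsColoring.single hyW (by
        rw [card_insert_of_notMem hycls, card_erase_add_one hz, hTcard W hWT])
    obtain ⟨g₃, hg₃⟩ := hrec y hyB
    obtain ⟨g₄, hg₄, -⟩ := hg₁.union h₂
      (by
        rw [disjoint_left]
        intro v hv hv'
        simp only [mem_filter, mem_erase, mem_insert, mem_colorClass] at hv hv'
        grind)
      (by simp)
    obtain ⟨g, hg, -⟩ := hg₄.union hg₃
      (by
        rw [disjoint_left]
        intro v hv hv'
        have := hBf v (mem_of_mem_erase hv')
        simp only [mem_filter, mem_erase, mem_insert, mem_colorClass, mem_union] at hv hv'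
        grind)
      (by
        rw [disjoint_left]
        intro c hc hc'
        simp only [mem_union, mem_erase, mem_singleton, mem_sdiff] at hc hc'
        grind)
    refine ⟨g, ?_⟩
    rwa [hWC W hWA, insert_union, insert_union, union_recolored hWA hz hyB,
      insert_erase (hclsX W hz)] at hg
  push Not at hswap
  -- Split class W by whether a vertex can move to another accessible class. With no exchange
  -- available, a movable in-neighbor of y is never its only in-neighbor in W.
  have hqT : q < #T := by
    obtain ⟨W, hWT⟩ := hTne
    have hWA := hTA hWT
    set p : V → Prop := fun z => ∃ d ∈ A, d ≠ W ∧ AcyclicOn R (insert z (colorClass Y f d)) with hp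
    refine lt_of_two_le_in_degrees (R := R) (M := (colorClass Y f W).filter p)
      (N := (colorClass Y f W).filter fun z => ¬ p z) (B := B) (fun y hy => ?_) (fun z hz => ?_)
      (fun z hz => ?_) ?_
    · obtain ⟨w, hw, hwy⟩ := (hclsAc W hWA).exists_in hR (hBm y hy W hWA)
      have hN : ∀ v ∈ colorClass Y f W, ¬ p v → R v y →
          1 ≤ #(((colorClass Y f W).filter fun z => ¬ p z).filter fun z => R z y) :=
        fun v hv hpv hvy => card_pos.2 ⟨v, mem_filter.2 ⟨mem_filter.2 ⟨hv, hpv⟩, hvy⟩⟩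
      by_cases hpw : p w
      · obtain ⟨d, hdA, hdW, hwd⟩ := id hpw
        have hne : ∃ w' ∈ (colorClass Y f W).erase w, R w' y := by
          by_contra! hcon
          exact hswap W hWT w hw d hdA hdW hwd y hy
            (((hclsAc W hWA).mono (erase_subset _ _)).insert_of_no_in hR hcon)
        obtain ⟨w', hw', hwy'⟩ := hne
        obtain ⟨hww, hw'⟩ := mem_erase.1 hw'
        by_cases hpw' : p w'
        · have : 1 < #(((colorClass Y f W).filter p).filter fun z => R z y) :=
            one_lt_card.2 ⟨w, mem_filter.2 ⟨mem_filter.2 ⟨hw, hpw⟩, hwy⟩, w',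
              mem_filter.2 ⟨mem_filter.2 ⟨hw', hpw'⟩, hwy'⟩, hww.symm⟩
          omega
        · have := hN w' hw' hpw' hwy'
          omega
      · have := hN w hw hpw hwy
        omega
    · obtain ⟨hz, hpz⟩ := mem_filter.1 hz
      have h1 := hsplit z (hclsX W hz)
      have h2 := hsum z (A.erase W) (erase_subset _ _) fun d hd hzd =>
        hpz ⟨d, mem_of_mem_erase hd, ne_of_mem_erase hd, hzd⟩
      have h3 := card_erase_add_one hWA
      omega
    -- A movable z can enter only U or classes of T, so it has an out-neighbor in each other
    -- accessible class.
    · obtain ⟨hz, hpz⟩ := mem_filter.1 hz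
      obtain ⟨hzY, hzW⟩ := mem_colorClass.1 hz
      have h1 := hsplit z (hclsX W hz)
      have h2 := hsum z (A \ insert U T) sdiff_subset fun d hd hzd => by
        obtain ⟨hdA, hdT⟩ := mem_sdiff.1 hd
        rw [mem_insert] at hdT
        exact hdT (hTU W hWT d ⟨hWA, hdA, z, hzY, hzW, hzd⟩ (reflTransGen_of_mem_accessible hdA))
      have h3 := le_card_sdiff (insert U T) A
      have h4 := card_insert_le U T
      omega
    · rw [card_filter_add_card_filter_not, hTcard W hWT, hBcard]
  -- two vertices of `B` with the same unique out-neighbor in a class of `T`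
  obtain ⟨P, hP⟩ : ∃ P : V → V → Prop, ∀ y z, P y z ↔
      R y z ∧ ∀ w ∈ colorClass Y f (f z), R y w → w = z := ⟨_, fun _ _ => Iff.rfl⟩
  have hTf := hf.restrict (hTA.trans hAC)
  obtain ⟨y, hyB, y', hyB', hne, hyy, z, hzS, hyz, hyz'⟩ :
      ∃ y ∈ B, ∃ y' ∈ B, y ≠ y' ∧ ¬ (R y y' ∧ R y' y) ∧
        ∃ z ∈ Y.filter (f · ∈ T), P y z ∧ P y' z := by
    -- In each class of T, out-neighbors and sole out-neighbors of y together number at least 2.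
    refine exists_common_solo P (fun y hy => ?_) hBq hqT hBcard ?_
    · have h1 := hsplit y (hBX hy)
      have h2 := hTf.card_filter fun z => P y z
      rw [sum_congr rfl fun c hc => by rw [colorClass_filter hc]] at h2
      have h3 : ∑ _c ∈ T, 2 ≤ ∑ c ∈ T, (#((colorClass Y f c).filter fun w => R y w) +
          #((colorClass Y f c).filter fun z => P y z)) := by
        refine sum_le_sum fun c hc => ?_
        obtain ⟨w, hw, hyw⟩ := (hclsAc c (hTA hc)).exists_out hR (hBm y hy c (hTA hc))
        have hw1 : w ∈ (colorClass Y f c).filter fun w => R y w := mem_filter.2 ⟨hw, hyw⟩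
        by_cases hu : ∀ v ∈ colorClass Y f c, R y v → v = w
        · have h4 : 0 < #((colorClass Y f c).filter fun w => R y w) := card_pos.2 ⟨w, hw1⟩
          have h5 : 0 < #((colorClass Y f c).filter fun z => P y z) :=
            card_pos.2 ⟨w, mem_filter.2 ⟨hw, (hP y w).2 ⟨hyw, by rwa [(mem_colorClass.1 hw).2]⟩⟩⟩
          omega
        · push Not at hu
          obtain ⟨v, hv, hyv, hvw⟩ := hu
          have : 1 < #((colorClass Y f c).filter fun w => R y w) :=
            one_lt_card.2 ⟨v, mem_filter.2 ⟨hv, hyv⟩, w, hw1, hvw⟩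
          omega
      have h4 : #(A \ T) ≤ ∑ c ∈ A \ T, #((colorClass Y f c).filter fun w => R y w) := by
        rw [card_eq_sum_ones]
        refine sum_le_sum fun c hc => ?_
        have hcA := (mem_sdiff.1 hc).1
        obtain ⟨w, hw, hyw⟩ := (hclsAc c hcA).exists_out hR (hBm y hy c hcA)
        exact card_pos.2 ⟨w, mem_filter.2 ⟨hw, hyw⟩⟩
      have h5 := sum_sdiff hTA (f := fun c => #((colorClass Y f c).filter fun w => R y w))
      have h6 := card_sdiff_add_card_eq_card hTA
      rw [sum_add_distrib, sum_const, smul_eq_mul, ← h2] at h3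
      omega
    · rw [hTf.card_eq, sum_congr rfl (g := fun _ => r + 1) fun c hc => if_neg (hT c hc).2.1,
        sum_const, smul_eq_mul]
  obtain ⟨hzY, hWT⟩ := mem_filter.1 hzS
  set W := f z with hW
  have hWA := hTA hWT
  have hWa : W ≠ a := (hT W hWT).2.1
  have hz : z ∈ colorClass Y f W := mem_colorClass.2 ⟨hzY, rfl⟩
  have hno : ∀ u, P u z → ∀ w ∈ (colorClass Y f W).erase z, ¬ R u w := fun u hu w hw huw =>
    ne_of_mem_erase hw (((hP u z).1 hu).2 w (mem_of_mem_erase hw) huw)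
  have hWz : AcyclicOn R ((colorClass Y f W).erase z) := (hclsAc W hWA).mono (erase_subset _ _)
  have hyW := hWz.insert_of_no_out hR (hno y hyz)
  -- Since y can replace z, the absence of exchanges means that z cannot move.
  have hzm : ∀ d ∈ A, d ≠ W → ¬ AcyclicOn R (insert z (colorClass Y f d)) :=
    fun d hd hdW hzd => hswap W hWT z hz d hd hdW hzd y hyB hyW
  have hyY : y ∈ Y → f y ∉ A := hBf y hyB
  have hycls : y ∉ (colorClass Y f W).erase z := fun h => by
    obtain ⟨h1, h2⟩ := mem_colorClass.1 (mem_of_mem_erase h)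
    exact hyY h1 (h2 ▸ hWA)
  have h₁ := hf.restrict ((erase_subset W A).trans hAC)
  have h₂ : IsColoring R (insert y ((colorClass Y f W).erase z)) {W} (fun _ => W)
      fun c => if c = a then r else r + 1 :=
    IsColoring.single hyW (by
      rw [card_insert_of_notMem hycls, card_erase_add_one hz, hTcard W hWT, if_neg hWa])
  obtain ⟨g₃, hg₃⟩ := hrec y hyB
  have h₃ := hg₃.congr_card (σ' := fun c => if c = a then r else r + 1) fun c hc => by
    rw [if_neg]
    rintro rfl
    exact (mem_sdiff.1 hc).2 haA
  obtain ⟨g₄, hg₄, hg₄₁, hg₄₂, -⟩ := h₁.union h₂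
    (by
      rw [disjoint_left]
      intro v hv hv'
      simp only [mem_filter, mem_erase, mem_insert, mem_colorClass] at hv hv'
      grind)
    (by simp)
  obtain ⟨g, hg, hg₁, -, hg₂⟩ := hg₄.union h₃
    (by
      rw [disjoint_left]
      intro v hv hv'
      have := hBf v (mem_of_mem_erase hv')
      simp only [mem_filter, mem_erase, mem_insert, mem_colorClass, mem_union] at hv hv'
      grind)
    (by
      rw [disjoint_left]
      intro c hc hc'
      simp only [mem_union, mem_erase, mem_singleton, mem_sdiff] at hc hc'
      grind)
  have hzX := hclsX W hz
  rw [hWC W hWA] at hg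
  rw [union_recolored hWA hz hyB] at hg hg₁
  have hgB : g y' ∉ A := by
    have := mem_erase.2 ⟨hne.symm, hyB'⟩
    rw [hg₂ y' this]
    exact (mem_sdiff.1 (hg₃.mem y' this)).2
  have hclsg : ∀ d ∈ A, d ≠ W → colorClass (X.erase z) g d = colorClass Y f d := by
    intro d hd hdW
    have hd' := mem_erase.2 ⟨hdW, hd⟩
    rw [hg₁ d (mem_union_left _ hd'), hg₄₁ d hd', colorClass_filter hd']
  have hclsgW : colorClass (X.erase z) g W = insert y ((colorClass Y f W).erase z) := by
    have hW' := mem_singleton_self W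
    rw [hg₁ W (mem_union_right _ hW'), hg₄₂ W hW', colorClass, filter_true_of_mem fun _ _ => rfl]
  have hmove : ∀ c d, c ∈ A → d ∈ A → c ≠ W → d ≠ W → CanMove R Y f c d →
      CanMove R (X.erase z) g c d := by
    rintro c d hc hd hcW hdW ⟨v, hv, rfl, hvd⟩
    have : v ∈ colorClass (X.erase z) g (f v) := by
      rw [hclsg _ hc hcW]; exact mem_colorClass.2 ⟨hv, rfl⟩
    obtain ⟨h1, h2⟩ := mem_colorClass.1 this
    exact ⟨v, h1, h2, by rwa [hclsg d hd hdW]⟩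
  have hacc : ∀ d ∈ A, d ≠ W → d ∈ accessible R (X.erase z) C g a := by
    intro d hd hdW
    refine mem_filter.2 ⟨hAC hd, ReflTransGen.mono (fun c e hce => ?_) _ _
      (hterm W hWT d (reflTransGen_of_mem_accessible hd) hdW)⟩
    exact ⟨hAC hce.1.1, hAC hce.1.2.1, hmove c e hce.1.1 hce.1.2.1 hce.2.1 hce.2.2 hce.1.2.2⟩
  -- The vertex that made W accessible is not z, so it is still in W.
  have hWacc : W ∈ accessible R (X.erase z) C g a := by
    obtain ⟨d, ⟨-, hdA, v, hvY, hvW, hvd⟩, hdW, -⟩ :=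
      exists_first_step_of_reflTransGen (reflTransGen_of_mem_accessible hWA) hWa
    refine mem_accessible_of_canMove (hacc d hdA hdW) (hAC hWA) ?_
    have hvz : v ≠ z := fun h => hzm d hdA hdW (h ▸ hvd)
    have : v ∈ colorClass (X.erase z) g W := by
      rw [hclsgW]
      exact mem_insert_of_mem (mem_erase.2 ⟨hvz, mem_colorClass.2 ⟨hvY, hvW⟩⟩)
    obtain ⟨h1, h2⟩ := mem_colorClass.1 this
    exact ⟨v, h1, h2, by rwa [hclsg d hdA hdW]⟩
  have hy'acc : g y' ∈ accessible R (X.erase z) C g a := by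
    have hy'z : y' ≠ z := fun h => hBf y' hyB' (h ▸ hzY) (h ▸ hWA)
    have hy' : y' ∈ X.erase z := mem_erase.2 ⟨hy'z, hBX hyB'⟩
    refine mem_accessible_of_canMove hWacc (hg.mem y' hy') ⟨y', hy', rfl, ?_⟩
    rw [hclsgW]
    exact hWz.insert_insert hR (hno y' hyz') (hno y hyz) fun h => hyy h.symm
  have hsub : insert (g y') A ⊆ accessible R (X.erase z) C g a := by
    refine insert_subset hy'acc fun d hd => ?_
    by_cases hdW : d = W
    · exact hdW ▸ hWacc
    · exact hacc d hd hdW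
  have hlt : #A < #(accessible R (X.erase z) C g a) := by
    have := card_le_card hsub
    rw [card_insert_of_notMem hgB] at this
    omega
  have hle := card_le_card (accessible_subset : accessible R (X.erase z) C g a ⊆ C)
  exact ihn _ (by omega) hzX hg rfl

/-! ### The divisible case, adding out-edges vertex by vertex -/

lemma exists_coloring_of_no_edges [Nonempty κ] {R : V → V → Prop} (hR : ∀ v w, ¬ R v w)
    {s : ℕ} {X : Finset V} {C : Finset κ} (hX : #X = #C * s) : ∃ g, IsColoring R X C g fun _ => s := by
  have hac : ∀ S : Finset V, AcyclicOn R S := fun S T _ ⟨v, hv⟩ => ⟨v, hv, fun w _ => hR v w⟩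
  induction C using Finset.induction_on generalizing X with
  | empty =>
    have : X = ∅ := by simpa using hX
    subst this
    exact ⟨fun _ => Classical.arbitrary κ, by simp, by simp, by simp⟩
  | insert c C hc ih =>
    rw [card_insert_of_notMem hc, add_mul, one_mul] at hX
    obtain ⟨S, hS, hScard⟩ := exists_subset_card_eq (s := X) (n := s) (by omega)
    obtain ⟨g, hg⟩ := ih (X := X \ S) (by rw [card_sdiff_of_subset hS]; omega)
    obtain ⟨g', hg', -⟩ := hg.union (IsColoring.single (hac S) (c := c) (σ := fun _ => s) hScard)
      sdiff_disjoint (by simpa using hc)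
    refine ⟨g', ?_⟩
    rwa [sdiff_union_of_subset hS, union_comm, ← insert_eq] at hg'

/-- A loopless relation on a finite set `X` with all out-degrees less than `#C`, where `#C` divides
`#X`, has an equitable acyclic coloring with colors from `C`. -/
theorem exists_equitable_coloring [Finite κ] [Nonempty κ] {s : ℕ} {R : V → V → Prop}
    (hR : ∀ v, ¬ R v v) {X : Finset V} {C : Finset κ} (hX : #X = #C * s)
    (hdeg : ∀ v ∈ X, #(X.filter fun w => R v w) < #C) :
    ∃ g, IsColoring R X C g fun _ => s := by
  induction hn : #X using Nat.strong_induction_on generalizing R X C with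
  | _ n ih =>
  subst hn
  rcases s with _ | r
  · have : X = ∅ := by simpa using hX
    subst this
    exact ⟨fun _ => Classical.arbitrary κ, by simp, fun c _ T hT hne => by
      obtain ⟨v, hv⟩ := hne; exact absurd (hT hv) (by simp), by simp [colorClass]⟩
  -- switch on the out-edges of the vertices one vertex after the other
  have key : ∀ L ⊆ X, ∃ g, IsColoring (fun v w => v ∈ L ∧ R v w) X C g fun _ => r + 1 := by
    intro L
    induction L using Finset.induction_on with
    | empty => exact fun _ => exists_coloring_of_no_edges (by simp) hX
    | insert u L hu ihL =>
      intro hL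
      obtain ⟨huX, hLX⟩ := insert_subset_iff.1 hL
      obtain ⟨g, hg⟩ := ihL hLX
      have hsub : ∀ (Z : Finset V) v, #(Z.filter fun w => v ∈ insert u L ∧ R v w) ≤
          #(Z.filter fun w => R v w) := fun Z v =>
        card_le_card (monotone_filter_right _ fun w _ h => h.2)
      refine exists_coloring_of_erase (a := g u) (x := u) (f := g) (fun v h => hR v h.2)
        (hg.mem u huX) hX (fun v hv => by convert Nat.lt_of_le_of_lt (hsub X v) (hdeg v hv))
        (fun X' hX' hlt C' hC' hdeg' => ih _ hlt (fun v h => hR v h.2) hC' hdeg' rfl) huX ?_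
      -- All new edges leave u, so without u the classes remain acyclic, and only the class of u
      -- loses a vertex.
      refine ⟨fun y hy => hg.mem y (mem_of_mem_erase hy), fun c hc T hT hne => ?_, fun c hc => ?_⟩
      · obtain ⟨v, hv, hvT⟩ := hg.acyclic c hc T
          (hT.trans (filter_subset_filter _ (erase_subset u X))) hne
        refine ⟨v, hv, fun w hw hvw => hvT w hw ⟨?_, hvw.2⟩⟩
        exact (mem_insert.1 hvw.1).resolve_left (ne_of_mem_erase (mem_colorClass.1 (hT hv)).1)
      · have h1 := hg.card c hc
        have h2 : colorClass (X.erase u) g c = (colorClass X g c).erase u := filter_erase _ _ _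
        rw [h2]
        by_cases hcu : c = g u
        · rw [if_pos hcu, card_erase_of_mem (mem_colorClass.2 ⟨huX, hcu.symm⟩), h1,
            Nat.add_sub_cancel]
        · rw [if_neg hcu, erase_eq_of_notMem fun h => hcu (mem_colorClass.1 h).2.symm, h1]
  obtain ⟨g, hg⟩ := key X Subset.rfl
  refine ⟨g, hg.mem, fun c hc T hT hne => ?_, hg.card⟩
  obtain ⟨v, hv, hvT⟩ := hg.acyclic c hc T hT hne
  exact ⟨v, hv, fun w hw hvw => hvT w hw ⟨(mem_colorClass.1 (hT hv)).1, hvw⟩⟩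

/-! ### From colorings to digraphs -/

/-- The vertices sharing a closed walk with v form a set without a sink. -/
lemma AcyclicOn.not_transGen {R : V → V → Prop} {S : Finset V} (h : AcyclicOn R S) {v : S}
    (hv : TransGen (fun x y : S => R x y) v v) : False := by
  let T : Finset S := univ.filter fun w =>
    TransGen (fun x y : S => R x y) v w ∧ TransGen (fun x y : S => R x y) w v
  obtain ⟨w, hw, hwT⟩ := h (T.map (Function.Embedding.subtype _))
    (fun x hx => by obtain ⟨y, -, rfl⟩ := mem_map.1 hx; exact y.2)
    ⟨v, mem_map.2 ⟨v, mem_filter.2 ⟨mem_univ _, hv, hv⟩, rfl⟩⟩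
  obtain ⟨w, hw', rfl⟩ := mem_map.1 hw
  obtain ⟨-, hvw, hwv⟩ := mem_filter.1 hw'
  obtain ⟨u, hwu, huv⟩ := TransGen.head'_iff.1 hwv
  refine hwT u (mem_map.2 ⟨u, mem_filter.2 ⟨mem_univ _, hvw.tail hwu, ?_⟩, rfl⟩) hwu
  rcases reflTransGen_iff_eq_or_transGen.1 huv with rfl | h
  · exact hv
  · exact h

/-- Remove sinks one after the other. -/
lemma AcyclicOn.exists_list {R : V → V → Prop} {S : Finset V} (h : AcyclicOn R S) :
    ∃ l : List V, l.Nodup ∧ l.toFinset = S ∧ l.Pairwise fun v w => ¬ R v w := by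
  induction S using Finset.strongInduction with
  | H S ih =>
    rcases S.eq_empty_or_nonempty with rfl | hne
    · exact ⟨[], by simp⟩
    · obtain ⟨v, hv, hvS⟩ := h S Subset.rfl hne
      obtain ⟨l, hl, hlS, hp⟩ := ih (S.erase v) (erase_ssubset hv) (h.mono (erase_subset _ _))
      have hmem : ∀ w, w ∈ l ↔ w ∈ S.erase v := fun w => by rw [← hlS, List.mem_toFinset]
      refine ⟨v :: l, List.nodup_cons.2 ⟨fun h' => ?_, hl⟩, ?_,
        List.pairwise_cons.2 ⟨fun w hw => ?_, hp⟩⟩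
      · exact notMem_erase v S ((hmem v).1 h')
      · rw [List.toFinset_cons, hlS, insert_erase hv]
      · exact hvS w (mem_of_mem_erase ((hmem w).1 hw))

end AcyclicColoring

open AcyclicColoring Finset

open scoped Classical in
lemma Digraph.outDegree_eq_card_filter {V : Type*} [Fintype V] (G : Digraph V) (v : V) :
    G.outDegree v = #(univ.filter fun w => G.Adj v w) := by
  rw [Digraph.outDegree, Set.ncard_eq_toFinset_card']
  simp

open scoped Classical in
lemma Digraph.exists_isEquitableAcyclicColoring {V : Type*} [Fintype V] (G : Digraph V)
    (hG : G.IsSimple) {k : ℕ} (hk : ∀ v, G.outDegree v < k) (hk0 : 0 < k) :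
    ∃ f : V → Fin k, G.IsEquitableAcyclicColoring f := by
  set n := Fintype.card V with hn
  -- complete the number of vertices to a multiple of `k` by adding a complete digraph
  let R : V ⊕ Fin (k - n % k) → V ⊕ Fin (k - n % k) → Prop
    | .inl v, .inl w => G.Adj v w
    | .inr i, .inr j => i ≠ j
    | _, _ => False
  have : NeZero k := ⟨hk0.ne'⟩
  have hmod := Nat.mod_lt n hk0
  obtain ⟨g, hg⟩ := exists_equitable_coloring (κ := Fin k) (s := n / k + 1) (R := R) (X := univ)
    (C := univ) (by rintro (v | i) h; exacts [hG v h, h rfl])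
    (by
      have := Nat.div_add_mod n k
      rw [card_univ, Fintype.card_sum, Fintype.card_fin, card_univ, Fintype.card_fin, ← hn,
        mul_add, mul_one]
      omega)
    (by
      rw [card_univ, Fintype.card_fin]
      rintro (v | i) -
      · have : univ.filter (fun w => R (.inl v) w) =
            (univ.filter fun w => G.Adj v w).map Function.Embedding.inl := by
          ext (w | j) <;> simp [R]
        rw [this, card_map, ← G.outDegree_eq_card_filter]
        exact hk v
      -- At most k vertices are added (exactly k if k divides n), so their out-degrees are below k.
      · have : univ.filter (fun w => R (.inr i) w) =
            (univ.erase i).map Function.Embedding.inr := by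
          ext (w | j) <;> simp [R, eq_comm]
        rw [this, card_map, card_erase_of_mem (mem_univ i), card_univ, Fintype.card_fin]
        omega)
  have hcls : ∀ c, (colorClass univ g c).toLeft = univ.filter fun v => g (.inl v) = c := by
    intro c; ext v; simp
  -- Two added vertices span a 2-cycle, so deleting the padding costs each class at most one vertex.
  have hright : ∀ c, #(colorClass univ g c).toRight ≤ 1 := by
    refine fun c => card_le_one.2 fun i hi j hj => ?_
    by_contra hij
    obtain ⟨v, hv, hvT⟩ := hg.acyclic c (mem_univ c) {.inr i, .inr j}
      (by
        rw [mem_toRight] at hi hj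
        exact insert_subset hi (singleton_subset_iff.2 hj)) ⟨.inr i, by simp⟩
    simp only [mem_insert, mem_singleton] at hv
    rcases hv with rfl | rfl
    · exact hvT (.inr j) (by simp) hij
    · exact hvT (.inr i) (by simp) (Ne.symm hij)
  have hcard : ∀ c, ((fun v => g (.inl v)) ⁻¹' {c}).ncard + #(colorClass univ g c).toRight =
      n / k + 1 := by
    intro c
    rw [← hg.card c (mem_univ c), ← card_toLeft_add_card_toRight, hcls,
      ← Set.ncard_coe_finset (univ.filter _)]
    congr 2
    ext v; simp
  refine ⟨fun v => g (.inl v), fun c v hv => ?_, fun c d => ?_⟩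
  · let e (w : ((fun v => g (.inl v)) ⁻¹' {c} : Set V)) : colorClass univ g c :=
      ⟨.inl w.1, mem_colorClass.2 ⟨mem_univ _, w.2⟩⟩
    exact (hg.acyclic c (mem_univ c)).not_transGen
      (Relation.TransGen.lift (r := (G.induce _).Adj) (p := fun x y => R x.1 y.1) e
        (fun _ _ h => h) _ _ hv)
  · have h1 := hcard c
    have h2 := hcard d
    have h3 := hright d
    omega

/-- Injective maps which send smaller to larger indices along edges and whose ranges partition the
vertices give a factor. -/
lemma Digraph.hasFactor_of_embeddings {V ι : Type*} (G : Digraph V) {s : ℕ} (e : ι → Fin s → V)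
    (hinj : ∀ c, Function.Injective (e c)) (hadj : ∀ c i j, i < j → G.Adj (e c i) (e c j))
    (hdisj : ∀ c d i j, e c i = e d j → c = d) (hcover : ∀ v, ∃ c i, e c i = v) :
    G.HasFactor (Digraph.transitiveTournament s) := by
  let T : ι → G.Subdigraph := fun c =>
    { verts := Set.range (e c)
      Adj := fun v w => ∃ i j, i < j ∧ e c i = v ∧ e c j = w
      adj_sub := by rintro _ _ ⟨i, j, hij, rfl, rfl⟩; exact hadj c i j hij
      fst_mem := by rintro _ _ ⟨i, j, hij, rfl, rfl⟩; exact ⟨i, rfl⟩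
      snd_mem := by rintro _ _ ⟨i, j, hij, rfl, rfl⟩; exact ⟨j, rfl⟩ }
  refine ⟨Set.range T, ?_, ?_, ?_⟩
  · rintro _ ⟨c, rfl⟩ _ ⟨d, rfl⟩ hcd
    refine Set.disjoint_left.2 ?_
    rintro _ ⟨i, rfl⟩ ⟨j, hj⟩
    exact hcd (congrArg T (hdisj c d i j hj.symm))
  · refine Set.eq_univ_of_forall fun v => ?_
    obtain ⟨c, i, hv⟩ := hcover v
    exact Set.mem_biUnion ⟨c, rfl⟩ ⟨i, hv⟩
  · rintro _ ⟨c, rfl⟩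
    refine ⟨⟨Equiv.ofInjective (e c) (hinj c), ?_⟩⟩
    intro i j
    constructor
    · rintro ⟨i', j', hij, hi, hj⟩
      rw [← hinj c hi, ← hinj c hj]
      exact hij
    · exact fun hij => ⟨i, j, hij, rfl, rfl⟩

open scoped Classical in
lemma Digraph.hasFactor_transitiveTournament {V : Type*} [Fintype V] (G : Digraph V)
    (hG : G.IsSimple) {s k : ℕ} (hcard : Fintype.card V = k * s)
    (hdeg : ∀ v, Fintype.card V ≤ G.outDegree v + k) :
    G.HasFactor (Digraph.transitiveTournament s) := by
  rcases Nat.eq_zero_or_pos k with rfl | hk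
  · rw [zero_mul, Fintype.card_eq_zero_iff] at hcard
    exact G.hasFactor_of_embeddings (ι := Empty) nofun nofun nofun nofun fun v => hcard.elim v
  have : NeZero k := ⟨hk.ne'⟩
  -- In this complement, a vertex v has out-degree n - 1 - d⁺(v) < k.
  obtain ⟨R, hR⟩ : ∃ R : V → V → Prop, ∀ v w, R v w ↔ v ≠ w ∧ ¬ G.Adj v w :=
    ⟨_, fun _ _ => Iff.rfl⟩
  obtain ⟨g, hg⟩ := exists_equitable_coloring (κ := Fin k) (s := s) (X := univ) (C := univ)
    (R := R) (fun v h => ((hR v v).1 h).1 rfl)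
    (by rw [card_univ, card_univ, Fintype.card_fin, hcard])
    (fun v _ => by
      refine lt_of_le_of_lt (card_le_card
        (t := (univ.filter fun w => ¬ G.Adj v w).erase v) fun w hw => ?_) ?_
      · have h := (hR v w).1 (mem_filter.1 hw).2
        exact mem_erase.2 ⟨h.1.symm, mem_filter.2 ⟨mem_univ w, h.2⟩⟩
      have h3 := card_erase_lt_of_mem (a := v) (s := univ.filter fun w => ¬ G.Adj v w)
        (by simpa using hG v)
      have h4 := card_filter_add_card_filter_not (s := univ) fun w => G.Adj v w
      have h5 := hdeg v
      rw [G.outDegree_eq_card_filter, ← card_univ] at h5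
      rw [card_univ (α := Fin k), Fintype.card_fin]
      omega)
  have hlist : ∀ c, ∃ e : Fin s → V, Function.Injective e ∧ (∀ v, g v = c ↔ ∃ i, e i = v) ∧
      ∀ i j, i < j → G.Adj (e i) (e j) := by
    intro c
    obtain ⟨l, hl, hlc, hp⟩ := (hg.acyclic c (mem_univ c)).exists_list
    have hs : l.length = s := by
      rw [← hg.card c (mem_univ c), ← hlc, List.toFinset_card_of_nodup hl]
    subst hs
    refine ⟨l.get, List.nodup_iff_injective_get.1 hl, fun v => ?_, fun i j hij => ?_⟩
    · rw [← List.mem_iff_get, ← List.mem_toFinset, hlc, mem_colorClass]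
      simp
    · by_contra hcon
      refine List.pairwise_iff_get.1 hp i j hij ((hR _ _).2 ⟨fun h => ?_, hcon⟩)
      exact hij.ne (List.nodup_iff_injective_get.1 hl h)
  choose e hinj hrange hadj using hlist
  refine G.hasFactor_of_embeddings e hinj hadj (fun c d i j h => ?_) fun v =>
    ⟨g v, (hrange (g v) v).1 rfl⟩
  rw [← (hrange c _).2 ⟨i, rfl⟩, h, (hrange d _).2 ⟨j, rfl⟩]

theorem theorem9 :
    (∀ (V : Type*) [Fintype V] (G : Digraph V) (s k : ℕ), G.IsSimple → 1 ≤ s →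
      Fintype.card V = s * k →
      (1 - 1 / (s : ℝ)) * (Fintype.card V : ℝ) ≤ (G.minOutDegree : ℝ) →
      G.HasFactor (Digraph.transitiveTournament s)) ∧
    (∀ (V : Type*) [Fintype V] (G : Digraph V) (k : ℕ), G.IsSimple →
      (G.maxOutDegree : ℤ) ≤ (k : ℤ) - 1 →
      ∃ f : V → Fin k, G.IsEquitableAcyclicColoring f) := by
  refine ⟨fun V _ G s k hG hs hcard hdeg => ?_, fun V _ G k hG hdeg => ?_⟩
  · refine G.hasFactor_transitiveTournament hG (k := k) (by rw [hcard, mul_comm]) fun v => ?_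
    have h1 : G.minOutDegree ≤ G.outDegree v := ciInf_le (OrderBot.bddBelow _) v
    have h2 : (Fintype.card V : ℝ) = s * k := by exact_mod_cast hcard
    have hs' : (s : ℝ) ≠ 0 := by positivity
    have h3 : (1 - 1 / (s : ℝ)) * (Fintype.card V : ℝ) = Fintype.card V - k := by
      rw [h2]; field_simp
    rw [h3] at hdeg
    have h4 : (G.minOutDegree : ℝ) ≤ G.outDegree v := by exact_mod_cast h1
    have h5 : (Fintype.card V : ℝ) ≤ (G.outDegree v + k : ℕ) := by push_cast; linarith
    exact_mod_cast h5
  · have hk : ∀ v, G.outDegree v ≤ G.maxOutDegree := fun v => le_sup (f := G.outDegree) (mem_univ v)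
    -- The bound over ℤ excludes k = 0, as `maxOutDegree` is a natural number.
    exact G.exists_isEquitableAcyclicColoring hG (fun v => by have := hk v; omega) (by omega)
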